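/- **Setting.** A *resource theory* on a state space $\Omega$ is a set $\mathcal T$ of maps on specifications (non-empty subsets of $\Omega$) that act element-wise, contain the identity and are closed under composition; write $V\to W$ if $f(V)\subseteq W$ for some $f\in\mathcal T$. A set $\mathcal C$ of specifications is a *currency* for a target $\mathcal S$ (a set of specifications) if (order) $\Omega\in\mathcal C$ and for all $C,C'\in\mathcal C$, $C\to C'$ or $C'\to C$; and (universality) $\Omega\in\mathcal S$ and for every $V\in\mathcal S$ there are $C,C'\in\mathcal C$ with $C\to V$ and $V\to C'$. It is *independent* of the target if for all $C,C'\in\mathcal C$ and $V\in\mathcal S$, $C\cap V\neq\emptyset$, and $C\to C'$ implies $C\cap V\to C'\cap V$. A *value function* is a map $\operatorname{Val}:\mathcal C\to\mathbb R_{\ge 0}$ with $\operatorname{Val}(\Omega)=0$ and $\operatorname{Val}(C')\ge\operatorname{Val}(C)\iff C'\to C$ for all $C,C'\in\mathcal C$. **Proposition (Bell pairs are a Stage II currency).** Let $N\in\mathbb N$ and let $\Omega$ be the set of density operators on $\bigl(\bigotimes_{i=1}^N A_i\otimes B_i\bigr)\otimes A'\otimes B'$, where $A_i,B_i$ are qubits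 and $A',B'$ consist of $N$ qubits each. Consider the resource theory whose transformations are $V\mapsto\Lambda(V)$ for two-party LOCC channels $\Lambda$ from the global system to itself, Alice holding $A'A_1\dots A_N$ and Bob $B'B_1\dots B_N$ (finitely many rounds of local instruments, with local ancillas allowed and outcomes communicated classically). Let $|\psi\rangle=(|00\rangle+|11\rangle)/\sqrt2$, and $$\Psi^n=\{\sigma\in\Omega:\ \sigma_{A_1B_1\dots A_nB_n}=|\psi\rangle\langle\psi|^{\otimes n}\}\quad(1\le n\le N),\qquad \Psi^0=\Omega,\qquad \mathcal C=\{\Psi^n\}_{n=0}^N .$$ Let $\mathcal S_0$ be any set of specifications that are local in $A'B'$, i.e. of the form $\{\sigma\in\Omega:\sigma_{A'B'}\in T\}$ with $T$ a non-empty set of density operators on $A'\otimes B'$ (for example all $\{\sigma:\sigma_{A'B'}=\rho\}$), and let $\mathcal S=\mathcal S_0\cup\{\Omega\}$. Then: 1. $\mathcal C$ is a currency for the target $\mathcal S$; 2. $\mathcal C$ is independent of the target $\mathcal S$; 3. $\mathcal C$ has a value function with $\operatorname{Val}(\Psi^n)=n$ for $0\le n\le N$; in particular $\Psi^n\to\Psi^m$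 if and only if $n\ge m$. -/

import Mathlib

open scoped ComplexOrder Kronecker

noncomputable section

namespace BellCurrency

/-! ### Resource theories on specifications, currencies, independence -/

/-- A resource theory on the state space `Ω`. Resources are specifications, that is, non-empty
subsets of `Ω`; the allowed transformations map specifications to specifications, act element-wise,
contain the identity and are closed under composition. -/
structure ResourceTheory (Ω : Type*) where
  transformations : Set (Set Ω → Set Ω)
  nonempty_map : ∀ f ∈ transformations, ∀ V : Set Ω, V.Nonempty → (f V).Nonempty
  elementwise : ∀ f ∈ transformations, ∀ V : Set Ω, f V = ⋃ ν ∈ V, f {ν}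
  id_mem : (fun V => V) ∈ transformations
  comp_mem : ∀ f ∈ transformations, ∀ g ∈ transformations, (fun V => g (f V)) ∈ transformations

/-- The accessibility relation `V → W`: some allowed transformation maps `V` into `W`. -/
def ResourceTheory.Reaches {Ω : Type*} (R : ResourceTheory Ω) (V W : Set Ω) : Prop :=
  ∃ f ∈ R.transformations, f V ⊆ W

/-- `𝒞` is a currency for the target `𝒮`. -/
structure IsCurrency {Ω : Type*} (R : ResourceTheory Ω) (𝒞 𝒮 : Set (Set Ω)) : Prop where
  currency_nonempty : ∀ C ∈ 𝒞, C.Nonempty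
  target_nonempty : ∀ V ∈ 𝒮, V.Nonempty
  order : ∀ C ∈ 𝒞, ∀ C' ∈ 𝒞, R.Reaches C C' ∨ R.Reaches C' C
  univ_mem_currency : Set.univ ∈ 𝒞
  universal_buy : ∀ V ∈ 𝒮, ∃ C ∈ 𝒞, R.Reaches C V
  universal_sell : ∀ V ∈ 𝒮, ∃ C ∈ 𝒞, R.Reaches V C
  univ_mem_target : Set.univ ∈ 𝒮

/-- The currency `𝒞` is independent of the target `𝒮`. -/
structure IsIndependent {Ω : Type*} (R : ResourceTheory Ω) (𝒞 𝒮 : Set (Set Ω)) : Prop where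
  compatible : ∀ C ∈ 𝒞, ∀ V ∈ 𝒮, (C ∩ V).Nonempty
  nondisturbing : ∀ C ∈ 𝒞, ∀ C' ∈ 𝒞, R.Reaches C C' →
    ∀ V ∈ 𝒮, R.Reaches (C ∩ V) (C' ∩ V)

/-- `val` (only its values on `𝒞` matter) is a value function of the currency `𝒞`. -/
structure IsValueFunction {Ω : Type*} (R : ResourceTheory Ω) (𝒞 : Set (Set Ω))
    (val : Set Ω → NNReal) : Prop where
  le_iff : ∀ C ∈ 𝒞, ∀ C' ∈ 𝒞, val C ≤ val C' ↔ R.Reaches C' C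
  univ_eq_zero : val Set.univ = 0

/-! ### States, marginals and LOCC -/

/-- Density operators on the Hilbert space with orthonormal basis indexed by `g`. -/
def State (g : Type) [Fintype g] : Type :=
  {ρ : Matrix g g ℂ // ρ.PosSemidef ∧ ρ.trace = 1}

section marginal

variable {g r t : Type} [Fintype t]

/-- Given an identification `e` of the system `g` with `r ⊗ t`, the partial trace over `t`. -/
def partialTrace (e : g ≃ r × t) (ρ : Matrix g g ℂ) : Matrix r r ℂ :=
  fun i j => ∑ k : t, ρ (e.symm (i, k)) (e.symm (j, k))

theorem partialTrace_posSemidef (e : g ≃ r × t) {ρ : Matrix g g ℂ} (h : ρ.PosSemidef) :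
    (partialTrace e ρ).PosSemidef := by
  have : partialTrace e ρ = ∑ k : t, ρ.submatrix (fun i => e.symm (i, k))
      (fun i => e.symm (i, k)) := by
    ext i j
    simp [partialTrace, Matrix.sum_apply]
  rw [this]
  exact Matrix.posSemidef_sum _ fun k _ => h.submatrix _

theorem partialTrace_trace [Fintype g] [Fintype r] (e : g ≃ r × t) (ρ : Matrix g g ℂ) :
    (partialTrace e ρ).trace = ρ.trace := by
  simp only [Matrix.trace, Matrix.diag, partialTrace]
  rw [← Fintype.sum_prod_type' (fun i k => ρ (e.symm (i, k)) (e.symm (i, k)))]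
  exact e.symm.sum_comp (fun x => ρ x x)

/-- The reduced state on `r` of a state on `g ≃ r ⊗ t`. -/
def marginal [Fintype g] [Fintype r] (e : g ≃ r × t) (ρ : State g) : State r :=
  ⟨partialTrace e ρ.1, partialTrace_posSemidef e ρ.2.1, (partialTrace_trace e ρ.1).trans ρ.2.2⟩

end marginal

/-- The linear map `X ↦ M X Mᴴ`. -/
def conj {m n : Type} [Fintype n] (M : Matrix m n ℂ) : Matrix n n ℂ →ₗ[ℂ] Matrix m m ℂ where
  toFun X := M * X * M.conjTranspose
  map_add' X Y := by rw [Matrix.mul_add, Matrix.add_mul]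
  map_smul' c X := by simp

/-- Two-party LOCC channels from `a ⊗ b` (Alice holds `a`, Bob holds `b`) to `a' ⊗ b'`:
finite protocols in which, in each round, one of the parties performs a local quantum instrument,
given by finitely many Kraus operators (into a possibly different local system, so that ancillas
may be introduced, kept and discarded), and communicates the outcome; the rest of the
protocol may depend on that outcome. -/
inductive IsLOCC {a' b' : Type} [Fintype a'] [DecidableEq a'] [Fintype b'] [DecidableEq b'] :
    ∀ {a b : Type} [Fintype a] [DecidableEq a] [Fintype b] [DecidableEq b],
      (Matrix (a × b) (a × b) ℂ →ₗ[ℂ] Matrix (a' × b') (a' × b') ℂ) → Prop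
  | done : IsLOCC (a := a') (b := b') LinearMap.id
  | alice {a b a₁ : Type} [Fintype a] [DecidableEq a] [Fintype b] [DecidableEq b]
      [Fintype a₁] [DecidableEq a₁] {κ : Type} [Fintype κ] (K : κ → Matrix a₁ a ℂ)
      (hK : ∑ k, (K k).conjTranspose * K k = 1)
      (Λ : κ → (Matrix (a₁ × b) (a₁ × b) ℂ →ₗ[ℂ] Matrix (a' × b') (a' × b') ℂ))
      (hΛ : ∀ k, IsLOCC (a := a₁) (b := b) (Λ k)) :
      IsLOCC (a := a) (b := b) (∑ k, Λ k ∘ₗ conj (K k ⊗ₖ (1 : Matrix b b ℂ)))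
  | bob {a b b₁ : Type} [Fintype a] [DecidableEq a] [Fintype b] [DecidableEq b]
      [Fintype b₁] [DecidableEq b₁] {κ : Type} [Fintype κ] (K : κ → Matrix b₁ b ℂ)
      (hK : ∑ k, (K k).conjTranspose * K k = 1)
      (Λ : κ → (Matrix (a × b₁) (a × b₁) ℂ →ₗ[ℂ] Matrix (a' × b') (a' × b') ℂ))
      (hΛ : ∀ k, IsLOCC (a := a) (b := b₁) (Λ k)) :
      IsLOCC (a := a) (b := b) (∑ k, Λ k ∘ₗ conj ((1 : Matrix a a ℂ) ⊗ₖ K k))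

section LOCC

variable {a b a' b' a'' b'' : Type} [Fintype a] [DecidableEq a] [Fintype b] [DecidableEq b]
  [Fintype a'] [DecidableEq a'] [Fintype b'] [DecidableEq b']
  [Fintype a''] [DecidableEq a''] [Fintype b''] [DecidableEq b'']

theorem IsLOCC.comp {Λ : Matrix (a × b) (a × b) ℂ →ₗ[ℂ] Matrix (a' × b') (a' × b') ℂ}
    {Γ : Matrix (a' × b') (a' × b') ℂ →ₗ[ℂ] Matrix (a'' × b'') (a'' × b'') ℂ}
    (hΛ : IsLOCC Λ) (hΓ : IsLOCC Γ) : IsLOCC (Γ ∘ₗ Λ) := by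
  induction hΛ with
  | done => simpa using hΓ
  | @alice a b a₁ _ _ _ _ _ _ κ _ K hK Λ _ ih =>
    rw [show Γ ∘ₗ (∑ k, Λ k ∘ₗ conj (K k ⊗ₖ (1 : Matrix b b ℂ))) = ∑ k, (Γ ∘ₗ Λ k) ∘ₗ conj (K k ⊗ₖ (1 : Matrix b b ℂ)) by
      ext1 X; simp [map_sum]]
    exact IsLOCC.alice K hK _ ih
  | @bob a b b₁ _ _ _ _ _ _ κ _ K hK Λ _ ih =>
    rw [show Γ ∘ₗ (∑ k, Λ k ∘ₗ conj ((1 : Matrix a a ℂ) ⊗ₖ K k)) = ∑ k, (Γ ∘ₗ Λ k) ∘ₗ conj ((1 : Matrix a a ℂ) ⊗ₖ K k) by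
      ext1 X; simp [map_sum]]
    exact IsLOCC.bob K hK _ ih

theorem conj_posSemidef {m n : Type} [Fintype m] [Fintype n] (M : Matrix m n ℂ)
    {X : Matrix n n ℂ} (hX : X.PosSemidef) : (conj M X).PosSemidef :=
  hX.mul_mul_conjTranspose_same M

theorem sum_conj_trace {m n κ : Type} [Fintype m] [Fintype n] [DecidableEq n] [Fintype κ]
    (M : κ → Matrix m n ℂ) (hM : ∑ k, (M k).conjTranspose * M k = 1) (X : Matrix n n ℂ) :
    ∑ k, (conj (M k) X).trace = X.trace := by
  calc ∑ k, (conj (M k) X).trace = ∑ k, ((M k).conjTranspose * M k * X).trace := by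
        refine Finset.sum_congr rfl fun k _ => ?_
        change (M k * X * (M k).conjTranspose).trace = _
        rw [Matrix.trace_mul_comm, Matrix.mul_assoc]
    _ = X.trace := by rw [← Matrix.trace_sum, ← Finset.sum_mul, hM, Matrix.one_mul]

theorem IsLOCC.posSemidef {Λ : Matrix (a × b) (a × b) ℂ →ₗ[ℂ] Matrix (a' × b') (a' × b') ℂ}
    (hΛ : IsLOCC Λ) {X : Matrix (a × b) (a × b) ℂ} (hX : X.PosSemidef) : (Λ X).PosSemidef := by
  induction hΛ with
  | done => simpa using hX
  | alice K hK Λ _ ih =>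
    rw [LinearMap.sum_apply]
    exact Matrix.posSemidef_sum _ fun k _ => ih k (conj_posSemidef _ hX)
  | bob K hK Λ _ ih =>
    rw [LinearMap.sum_apply]
    exact Matrix.posSemidef_sum _ fun k _ => ih k (conj_posSemidef _ hX)

theorem IsLOCC.trace {Λ : Matrix (a × b) (a × b) ℂ →ₗ[ℂ] Matrix (a' × b') (a' × b') ℂ}
    (hΛ : IsLOCC Λ) (X : Matrix (a × b) (a × b) ℂ) : (Λ X).trace = X.trace := by
  induction hΛ with
  | done => simp
  | @alice a b a₁ _ _ _ _ _ _ κ _ K hK Λ _ ih =>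
    rw [LinearMap.sum_apply, Matrix.trace_sum]
    simp only [LinearMap.comp_apply, ih]
    refine sum_conj_trace _ ?_ X
    simp only [Matrix.conjTranspose_kronecker, ← Matrix.mul_kronecker_mul,
      Matrix.conjTranspose_one, Matrix.mul_one]
    have h := congrArg (fun A => A ⊗ₖ (1 : Matrix b b ℂ)) hK
    simp only [Matrix.one_kronecker_one] at h
    rw [← h]
    ext ⟨i, j⟩ ⟨i', j'⟩
    simp [Matrix.sum_apply, Finset.sum_mul]
  | @bob a b b₁ _ _ _ _ _ _ κ _ K hK Λ _ ih =>
    rw [LinearMap.sum_apply, Matrix.trace_sum]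
    simp only [LinearMap.comp_apply, ih]
    refine sum_conj_trace _ ?_ X
    simp only [Matrix.conjTranspose_kronecker, ← Matrix.mul_kronecker_mul,
      Matrix.conjTranspose_one, Matrix.mul_one]
    have h := congrArg (fun A => (1 : Matrix a a ℂ) ⊗ₖ A) hK
    simp only [Matrix.one_kronecker_one] at h
    rw [← h]
    ext ⟨i, j⟩ ⟨i', j'⟩
    simp [Matrix.sum_apply, Finset.mul_sum]

/-- The action of an LOCC channel on states. -/
def IsLOCC.onState {Λ : Matrix (a × b) (a × b) ℂ →ₗ[ℂ] Matrix (a' × b') (a' × b') ℂ}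
    (hΛ : IsLOCC Λ) (ρ : State (a × b)) : State (a' × b') :=
  ⟨Λ ρ.1, hΛ.posSemidef ρ.2.1, (hΛ.trace ρ.1).trans ρ.2.2⟩

/-- The resource theory of two-party LOCC on `a ⊗ b`: the transformations are `V ↦ Λ(V)` for LOCC
channels `Λ` from `a ⊗ b` to itself. -/
def loccTheory (a b : Type) [Fintype a] [DecidableEq a] [Fintype b] [DecidableEq b] :
    ResourceTheory (State (a × b)) where
  transformations := {f | ∃ (Λ : Matrix (a × b) (a × b) ℂ →ₗ[ℂ] Matrix (a × b) (a × b) ℂ)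
    (hΛ : IsLOCC Λ), ∀ V, f V = hΛ.onState '' V}
  nonempty_map := by
    rintro f ⟨Λ, hΛ, hf⟩ V hV
    rw [hf]
    exact hV.image _
  elementwise := by
    rintro f ⟨Λ, hΛ, hf⟩ V
    simp only [hf, Set.image_singleton]
    ext σ
    simp [eq_comm]
  id_mem := by
    refine ⟨LinearMap.id, IsLOCC.done, fun V => ?_⟩
    exact (Set.image_id V).symm
  comp_mem := by
    rintro f ⟨Λ, hΛ, hf⟩ g ⟨Γ, hΓ, hg⟩
    refine ⟨Γ ∘ₗ Λ, hΛ.comp hΓ, fun V => ?_⟩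
    change g (f V) = _
    rw [hg, hf, Set.image_image]
    rfl

end LOCC

/-! ### Bell pairs in the wallet, local target specifications -/

/-- Computational basis of a register of qubits labelled by `s`. -/
abbrev Qubits (s : Type) : Type := s → Fin 2

/-- One party's system: its `N` wallet qubits and its `N` target qubits. -/
abbrev Party (N : ℕ) : Type := Qubits (Fin N) × Qubits (Fin N)

/-- Global states, of the systems `A₁ … A_N, A'` held by Alice and `B₁ … B_N, B'` held by Bob. -/
abbrev Global (N : ℕ) : Type := State (Party N × Party N)

/-- Global system = (wallet `A₁ … A_N B₁ … B_N`) ⊗ (target `A' B'`). -/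
def walletTarget (N : ℕ) : Party N × Party N ≃
    (Qubits (Fin N) × Qubits (Fin N)) × (Qubits (Fin N) × Qubits (Fin N)) :=
  Equiv.prodProdProdComm _ _ _ _

/-- Wallet = (the first `n` pairs) ⊗ (the remaining pairs). -/
def firstPairs (N n : ℕ) : Qubits (Fin N) × Qubits (Fin N) ≃
    (Qubits {i : Fin N // i.val < n} × Qubits {i : Fin N // i.val < n}) ×
      (Qubits {i : Fin N // ¬ i.val < n} × Qubits {i : Fin N // ¬ i.val < n}) :=
  ((Equiv.piEquivPiSubtypeProd (fun i : Fin N => i.val < n) (fun _ => Fin 2)).prodCongr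
    (Equiv.piEquivPiSubtypeProd (fun i : Fin N => i.val < n) (fun _ => Fin 2))).trans
    (Equiv.prodProdProdComm _ _ _ _)

/-- The reduced state `σ_{A₁ B₁ … A_N B_N}` of the wallet. -/
def walletMarginal {N : ℕ} (σ : Global N) : State (Qubits (Fin N) × Qubits (Fin N)) :=
  marginal (walletTarget N) σ

/-- The reduced state `σ_{A'B'}` of the target. -/
def targetMarginal {N : ℕ} (σ : Global N) : State (Qubits (Fin N) × Qubits (Fin N)) :=
  marginal ((walletTarget N).trans (Equiv.prodComm _ _)) σ

/-- The amplitudes of `|ψ⟩ = (|00⟩ + |11⟩) / √2`. -/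
def bellVec (x y : Fin 2) : ℂ := if x = y then 1 / (Real.sqrt 2 : ℂ) else 0

/-- The projector onto `⨂_{i ∈ s} |ψ⟩_{A_i B_i}`. -/
def bellProjector (s : Type) [Fintype s] : Matrix (Qubits s × Qubits s) (Qubits s × Qubits s) ℂ :=
  Matrix.vecMulVec (fun p => ∏ i, bellVec (p.1 i) (p.2 i))
    (star fun p => ∏ i, bellVec (p.1 i) (p.2 i))

/-- The specification `Ψⁿ`: the first `n` wallet pairs are Bell states. -/
def bellSpec (N n : ℕ) : Set (Global N) :=
  {σ | (marginal (firstPairs N n) (walletMarginal σ)).1 = bellProjector {i : Fin N // i.val < n}}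

/-- The currency `{Ψⁿ}_{n=1}^N ∪ {Ω}`. -/
def bellCurrency (N : ℕ) : Set (Set (Global N)) :=
  {C | ∃ n, 1 ≤ n ∧ n ≤ N ∧ C = bellSpec N n} ∪ {Set.univ}

/-- The specification "the state of `A'B'` lies in `T`". For `T = {ρ}` this is the set of all global
states with reduced state `ρ` on `A'B'`. -/
def localSpec {N : ℕ} (T : Set (State (Qubits (Fin N) × Qubits (Fin N)))) : Set (Global N) :=
  {σ | targetMarginal σ ∈ T}

/-- Local target specifications: `localSpec T` for a non-empty set `T` of states of `A'B'`. -/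
def localSpecs (N : ℕ) : Set (Set (Global N)) :=
  {V | ∃ T : Set (State (Qubits (Fin N) × Qubits (Fin N))), T.Nonempty ∧ V = localSpec T}

end BellCurrency

end

/-! The sets `Ψⁿ` shrink as `n` grows, since tracing out some of `n` Bell pairs leaves the others
(`bellSpec_anti`). So `Ψⁿ → Ψᵐ` for `m ≤ n` holds by the identity channel, and intersecting these
inclusions with `V` shows that spending leaves the target undisturbed.

The converse rests on the Schmidt number. A local Kraus operator multiplies the coefficient matrix
of a bipartite vector on the left or on the right, so a factorisation of that matrix through a small
index set survives every LOCC round (`IsLOCC.schmidtLE`). `Ψⁿ` contains `n` Bell pairs times a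
product state, of Schmidt number at most `2ⁿ` (`exists_mem_bellSpec_schmidtLE`), whereas `m` Bell
pairs need `2ᵐ` (`card_le_of_schmidtLE_maxEnt`); hence `m ≤ n`.

Every target can be bought with `Ψᴺ`: its wallet is exactly a maximally entangled state of dimension
`2ᴺ`, enough to teleport Bob's `N`-qubit half of any state of `A'B'` (`exists_isLOCC_prepare`).
Selling is trivial because `Ω` belongs to the currency, and compatibility is witnessed by product
states. -/

noncomputable section

namespace BellCurrency

/-! ### Maximally entangled and product states -/

/-- The projector onto the maximally entangled vector of `κ ⊗ κ`. -/
def maxEnt (κ : Type) [Fintype κ] [DecidableEq κ] : Matrix (κ × κ) (κ × κ) ℂ :=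
  fun p q => if p.1 = p.2 ∧ q.1 = q.2 then (Fintype.card κ : ℂ)⁻¹ else 0

theorem prod_bellVec {s : Type} [Fintype s] (x y : Qubits s) :
    ∏ i, bellVec (x i) (y i) =
      if x = y then (1 / (Real.sqrt 2 : ℂ)) ^ Fintype.card s else 0 := by
  classical
  split_ifs with h
  · subst h
    simp [bellVec, Finset.prod_const]
  · obtain ⟨i, hi⟩ := Function.ne_iff.1 h
    exact Finset.prod_eq_zero (Finset.mem_univ i) (by simp [bellVec, hi])

/-- Across the cut between Alice and Bob, several Bell pairs are a single maximally entangled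
vector. All later arguments use only this form. -/
theorem bellProjector_eq_maxEnt (s : Type) [Fintype s] [DecidableEq s] :
    bellProjector s = maxEnt (Qubits s) := by
  have h2 : (Real.sqrt 2 : ℂ) * (Real.sqrt 2 : ℂ) = 2 := by
    rw [← Complex.ofReal_mul, Real.mul_self_sqrt (by norm_num)]
    norm_num
  ext p q
  simp only [bellProjector, Matrix.vecMulVec_apply, Pi.star_apply, prod_bellVec, maxEnt]
  by_cases hp : p.1 = p.2 <;> by_cases hq : q.1 = q.2 <;> simp [hp, hq]
  rw [← mul_inv, ← mul_pow, h2]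

section maxEnt

variable {κ r t : Type} [Fintype κ] [DecidableEq κ] [Fintype r] [DecidableEq r] [Fintype t]

/-- Only the terms with `z = w` survive, and there are `|t|` of them, each equal to `1 / (|r| |t|)`.
-/
theorem sum_maxEnt [Nonempty κ] (f : κ ≃ r × t) (x y x' y' : r) :
    ∑ z : t, ∑ w : t,
      maxEnt κ (f.symm (x, z), f.symm (y, w)) (f.symm (x', z), f.symm (y', w)) =
      maxEnt r (x, y) (x', y') := by
  classical
  have hc : (Fintype.card κ : ℂ) = Fintype.card r * Fintype.card t := by
    rw [Fintype.card_congr f, Fintype.card_prod]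
    push_cast
    rfl
  have h0 : (Fintype.card κ : ℂ) ≠ 0 := by simp
  rw [hc] at h0
  obtain ⟨h1, h2⟩ := mul_ne_zero_iff.1 h0
  by_cases hx : x = y <;> by_cases hx' : x' = y' <;>
    simp [maxEnt, hx, hx', hc]
  field_simp

theorem maxEnt_eq_vecMulVec [Nonempty κ] : maxEnt κ =
    Matrix.vecMulVec (fun p => if p.1 = p.2 then ((Real.sqrt (Fintype.card κ) : ℝ) : ℂ)⁻¹ else 0)
      (star fun p => if p.1 = p.2 then ((Real.sqrt (Fintype.card κ) : ℝ) : ℂ)⁻¹ else 0) := by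
  have h2 : ((Real.sqrt (Fintype.card κ) : ℝ) : ℂ) * ((Real.sqrt (Fintype.card κ) : ℝ) : ℂ) =
      Fintype.card κ := by
    rw [← Complex.ofReal_mul, Real.mul_self_sqrt (Nat.cast_nonneg _)]
    simp
  ext p q
  by_cases hp : p.1 = p.2 <;> by_cases hq : q.1 = q.2 <;>
    simp [Matrix.vecMulVec_apply, maxEnt, hp, hq]
  rw [← mul_inv, h2]

/-- The maximally entangled state of `κ ⊗ κ`. -/
def maxEntState (κ : Type) [Fintype κ] [DecidableEq κ] [Nonempty κ] : State (κ × κ) :=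
  ⟨maxEnt κ, by
    rw [maxEnt_eq_vecMulVec]
    exact Matrix.posSemidef_vecMulVec_self_star _, by
    simp [Matrix.trace, maxEnt, Fintype.sum_prod_type]⟩

end maxEnt

/-- The pure basis state labelled by `i`. -/
def basisState {g : Type} [Fintype g] [DecidableEq g] (i : g) : State g :=
  ⟨Matrix.vecMulVec (Pi.single i 1) (star (Pi.single i 1)),
    Matrix.posSemidef_vecMulVec_self_star _, by
    simp [Matrix.trace, Matrix.vecMulVec_apply, Pi.single_apply]⟩

section product

variable {g r t : Type} [Fintype g] [Fintype r] [Fintype t]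

/-- The product state of `A` and `B` on a system identified with `r ⊗ t`. -/
def prodState (e : g ≃ r × t) (A : State r) (B : State t) : State g :=
  ⟨(A.1 ⊗ₖ B.1).submatrix e e, (A.2.1.kronecker B.2.1).submatrix _, by
    rw [Matrix.trace, show (∑ i, ((A.1 ⊗ₖ B.1).submatrix e e).diag i) = (A.1 ⊗ₖ B.1).trace from
      e.sum_comp fun i => (A.1 ⊗ₖ B.1) i i, Matrix.trace_kronecker, A.2.2, B.2.2, mul_one]⟩

theorem marginal_prodState (e : g ≃ r × t) (A : State r) (B : State t) :
    marginal e (prodState e A B) = A := by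
  have hB : ∑ k, B.1 k k = 1 := B.2.2
  refine Subtype.ext ?_
  ext i j
  simp [marginal, partialTrace, prodState, ← Finset.mul_sum, hB]

theorem marginal_prodComm_prodState (e : g ≃ r × t) (A : State r) (B : State t) :
    marginal (e.trans (Equiv.prodComm _ _)) (prodState e A B) = B := by
  have hA : ∑ k, A.1 k k = 1 := A.2.2
  refine Subtype.ext ?_
  ext i j
  simp [marginal, partialTrace, prodState, ← Finset.sum_mul, hA]

end product

/-! ### The specifications `Ψⁿ` are nested -/

section split

variable {ι : Type} {p q : ι → Prop} [DecidablePred p] [DecidablePred q]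

/-- Splitting the qubits with property `q` into those with the stronger property `p` and the
others. -/
def splitInner (h : ∀ i, p i → q i) :
    Qubits {i // q i} ≃ Qubits {i // p i} × Qubits {i // q i ∧ ¬ p i} where
  toFun x := (fun i => x ⟨i, h i i.2⟩, fun i => x ⟨i, i.2.1⟩)
  invFun a i := if hi : p i then a.1 ⟨i, hi⟩ else a.2 ⟨i, i.2, hi⟩
  left_inv x := by ext i; by_cases hi : p i <;> simp [hi]
  right_inv a := by
    ext i
    · simp [i.2]
    · simp [i.2.2]

/-- Splitting the qubits without property `p` into those with the weaker property `q` and the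
others. -/
def splitOuter (h : ∀ i, p i → q i) :
    Qubits {i // ¬ p i} ≃ Qubits {i // q i ∧ ¬ p i} × Qubits {i // ¬ q i} where
  toFun x := (fun i => x ⟨i, i.2.2⟩, fun i => x ⟨i, fun hi => i.2 (h i hi)⟩)
  invFun a i := if hi : q i then a.1 ⟨i, hi, i.2⟩ else a.2 ⟨i, hi⟩
  left_inv x := by ext i; by_cases hi : q i <;> simp [hi]
  right_inv a := by
    ext i
    · simp [i.2.1]
    · simp [i.2]

/-- Both sides glue the same three blocks `p`, `q ∧ ¬ p` and `¬ q`. This is the associativity needed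
to take a partial trace in two stages. -/
theorem piEquivPiSubtypeProd_symm_splitOuter (h : ∀ i, p i → q i) (x : Qubits {i // p i})
    (z : Qubits {i // q i ∧ ¬ p i}) (z' : Qubits {i // ¬ q i}) :
    (Equiv.piEquivPiSubtypeProd p (fun _ => Fin 2)).symm (x, (splitOuter h).symm (z, z')) =
      (Equiv.piEquivPiSubtypeProd q (fun _ => Fin 2)).symm ((splitInner h).symm (x, z), z') := by
  ext i
  by_cases hp : p i
  · simp [Equiv.piEquivPiSubtypeProd, splitInner, splitOuter, hp, h i hp]
  · by_cases hq : q i <;> simp [Equiv.piEquivPiSubtypeProd, splitInner, splitOuter, hp, hq]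

end split

/-- The qubits of one party, split into the first `n` and the others. -/
abbrev firstQubits (N n : ℕ) : Qubits (Fin N) ≃
    Qubits {i : Fin N // i.val < n} × Qubits {i : Fin N // ¬ i.val < n} :=
  Equiv.piEquivPiSubtypeProd (fun i : Fin N => i.val < n) (fun _ => Fin 2)

/-- The partial trace is written with separate sums for Alice and Bob, so that each party's qubits
can be regrouped independently. -/
theorem mem_bellSpec_iff {N n : ℕ} {σ : Global N} : σ ∈ bellSpec N n ↔ ∀ x y x' y',
    ∑ z, ∑ w, (walletMarginal σ).1
      ((firstQubits N n).symm (x, z), (firstQubits N n).symm (y, w))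
      ((firstQubits N n).symm (x', z), (firstQubits N n).symm (y', w)) =
    maxEnt (Qubits {i : Fin N // i.val < n}) (x, y) (x', y') := by
  rw [bellSpec, Set.mem_ofPred_eq, bellProjector_eq_maxEnt]
  constructor
  · intro h x y x' y'
    rw [← h]
    symm
    exact Fintype.sum_prod_type _
  · intro h
    ext ⟨x, y⟩ ⟨x', y'⟩
    rw [← h]
    exact Fintype.sum_prod_type _

theorem bellSpec_anti {N m n : ℕ} (hmn : m ≤ n) : bellSpec N n ⊆ bellSpec N m := by
  intro σ hσ
  rw [mem_bellSpec_iff] at hσ ⊢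
  intro x y x' y'
  have h : ∀ i : Fin N, i.val < m → i.val < n := fun i hi => hi.trans_le hmn
  -- The traced-out qubits, with indices at least `m`, split into those below `n` and the rest.
  -- Summing the rest first gives the marginal on `n` pairs, which is known.
  rw [← sum_maxEnt (splitInner h), ← (splitOuter h).symm.sum_comp, Fintype.sum_prod_type]
  refine Finset.sum_congr rfl fun z _ => ?_
  simp_rw [← (splitOuter h).symm.sum_comp (fun w => (walletMarginal σ).1 (_, (firstQubits N m).symm
    (y, w)) (_, (firstQubits N m).symm (y', w))), Fintype.sum_prod_type]
  rw [Finset.sum_comm]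
  refine Finset.sum_congr rfl fun w _ => ?_
  simp_rw [firstQubits, piEquivPiSubtypeProd_symm_splitOuter]
  exact hσ _ _ _ _

theorem bellSpec_zero (N : ℕ) : bellSpec N 0 = Set.univ := by
  refine Set.eq_univ_of_forall fun σ => ?_
  rw [bellSpec, Set.mem_ofPred_eq, bellProjector_eq_maxEnt]
  have : IsEmpty {i : Fin N // i.val < 0} := ⟨fun i => absurd i.2 (Nat.not_lt_zero _)⟩
  have h1 := (marginal (firstPairs N 0) (walletMarginal σ)).2.2
  ext p q
  -- The marginal on zero pairs is a `1 × 1` matrix, hence determined by its trace.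
  rw [Matrix.trace, Fintype.sum_subsingleton _ p] at h1
  rw [Subsingleton.elim q p]
  refine h1.trans ?_
  simp [maxEnt, Subsingleton.elim p.1 p.2]

theorem walletMarginal_of_mem_bellSpec {N : ℕ} {σ : Global N} (hσ : σ ∈ bellSpec N N) :
    (walletMarginal σ).1 = maxEnt (Qubits (Fin N)) := by
  have : IsEmpty {i : Fin N // ¬ i.val < N} := ⟨fun i => i.2 i.1.2⟩
  rw [mem_bellSpec_iff] at hσ
  generalize (walletMarginal σ).1 = M at hσ ⊢
  have hx : ∀ x z, (firstQubits N N).symm (((firstQubits N N) x).1, z) = x := fun x z => by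
    rw [Equiv.symm_apply_eq]
    exact Prod.ext rfl (Subsingleton.elim _ _)
  ext ⟨x, y⟩ ⟨x', y'⟩
  have h := hσ ((firstQubits N N) x).1 ((firstQubits N N) y).1 ((firstQubits N N) x').1
    ((firstQubits N N) y').1
  rw [← sum_maxEnt (firstQubits N N)] at h
  simpa only [hx, Finset.sum_const, Finset.card_univ, Fintype.card_unique, one_smul] using h

theorem mem_bellSpec_of_walletMarginal {N : ℕ} {σ : Global N}
    (hσ : (walletMarginal σ).1 = maxEnt (Qubits (Fin N))) (n : ℕ) : σ ∈ bellSpec N n := by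
  rw [mem_bellSpec_iff, hσ]
  exact sum_maxEnt (firstQubits N n)

theorem bellSpec_inter_localSpec_nonempty {N : ℕ}
    {T : Set (State (Qubits (Fin N) × Qubits (Fin N)))} (hT : T.Nonempty) (n : ℕ) :
    (bellSpec N n ∩ localSpec T).Nonempty := by
  obtain ⟨ρ, hρ⟩ := hT
  -- All `N` Bell pairs tensored with `ρ` lie in every `Ψⁿ` at once.
  refine ⟨prodState (walletTarget N) (maxEntState _) ρ,
    mem_bellSpec_of_walletMarginal ?_ n, ?_⟩
  · rw [walletMarginal, marginal_prodState]
    rfl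
  · rwa [localSpec, Set.mem_ofPred_eq, targetMarginal, marginal_prodComm_prodState]

/-! ### LOCC cannot increase the Schmidt number -/

/-- `X` is a sum of rank-one projectors onto vectors of `a ⊗ b` of Schmidt rank at most the
cardinality of `κ`. -/
def SchmidtLE (κ : Type) [Fintype κ] {a b : Type} (X : Matrix (a × b) (a × b) ℂ) : Prop :=
  ∃ (ι : Type) (_ : Fintype ι) (L : ι → Matrix a κ ℂ) (R : ι → Matrix κ b ℂ),
    X = ∑ i, Matrix.vecMulVec (fun p => (L i * R i) p.1 p.2) (star fun p => (L i * R i) p.1 p.2)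

theorem SchmidtLE.sum {κ : Type} [Fintype κ] {a b μ : Type} [Fintype μ]
    {X : μ → Matrix (a × b) (a × b) ℂ} (hX : ∀ m, SchmidtLE κ (X m)) :
    SchmidtLE κ (∑ m, X m) := by
  choose ι hι L R h using hX
  refine ⟨Σ m, ι m, inferInstance, fun i => L i.1 i.2, fun i => R i.1 i.2, ?_⟩
  rw [Fintype.sum_sigma]
  exact Finset.sum_congr rfl fun m _ => h m

theorem conj_vecMulVec {m n : Type} [Fintype n] (M : Matrix m n ℂ) (v : n → ℂ) :
    conj M (Matrix.vecMulVec v (star v)) =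
      Matrix.vecMulVec (M.mulVec v) (star (M.mulVec v)) := by
  change M * Matrix.vecMulVec v (star v) * M.conjTranspose = _
  rw [Matrix.mul_vecMulVec, Matrix.vecMulVec_mul, Matrix.star_mulVec]

/-- In terms of coefficient matrices, local operators act by `V ↦ A V Bᵀ`. This drives both the
Schmidt bound and the teleportation computation. -/
theorem kronecker_mulVec_uncurry {a b a' b' : Type} [Fintype a] [Fintype b]
    (A : Matrix a' a ℂ) (B : Matrix b' b ℂ) (V : Matrix a b ℂ) :
    (A ⊗ₖ B).mulVec (fun p => V p.1 p.2) = fun p => (A * V * B.transpose) p.1 p.2 := by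
  ext p
  simp only [Matrix.mulVec, dotProduct, Fintype.sum_prod_type, Matrix.mul_apply,
    Matrix.kroneckerMap_apply, Matrix.transpose_apply, Finset.sum_mul]
  rw [Finset.sum_comm]
  refine Finset.sum_congr rfl fun _ _ => Finset.sum_congr rfl fun _ _ => ?_
  ring

theorem SchmidtLE.conj_kronecker {κ : Type} [Fintype κ] {a b a' b' : Type} [Fintype a] [Fintype b]
    (A : Matrix a' a ℂ) (B : Matrix b' b ℂ) {X : Matrix (a × b) (a × b) ℂ} (hX : SchmidtLE κ X) :
    SchmidtLE κ (conj (A ⊗ₖ B) X) := by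
  obtain ⟨ι, _, L, R, rfl⟩ := hX
  refine ⟨ι, inferInstance, fun i => A * L i, fun i => R i * B.transpose, ?_⟩
  rw [map_sum]
  refine Finset.sum_congr rfl fun i _ => ?_
  rw [conj_vecMulVec, kronecker_mulVec_uncurry]
  simp only [Matrix.mul_assoc]

theorem IsLOCC.schmidtLE {κ : Type} [Fintype κ] {a b a' b' : Type} [Fintype a] [DecidableEq a]
    [Fintype b] [DecidableEq b] [Fintype a'] [DecidableEq a'] [Fintype b'] [DecidableEq b']
    {Λ : Matrix (a × b) (a × b) ℂ →ₗ[ℂ] Matrix (a' × b') (a' × b') ℂ}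
    (hΛ : IsLOCC Λ) {X : Matrix (a × b) (a × b) ℂ} (hX : SchmidtLE κ X) : SchmidtLE κ (Λ X) := by
  induction hΛ with
  | done => simpa using hX
  | alice K hK Λ _ ih =>
    rw [LinearMap.sum_apply]
    exact SchmidtLE.sum fun k => ih k (hX.conj_kronecker _ _)
  | bob K hK Λ _ ih =>
    rw [LinearMap.sum_apply]
    exact SchmidtLE.sum fun k => ih k (hX.conj_kronecker _ _)

/-- Discarding local subsystems does not increase the Schmidt number. -/
theorem SchmidtLE.marginal {κ : Type} [Fintype κ] {a b r r' t : Type} [Fintype t]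
    {X : Matrix (a × b) (a × b) ℂ} (hX : SchmidtLE κ X) (f : t → r → a) (g : t → r' → b) :
    SchmidtLE κ (∑ k, X.submatrix (fun p : r × r' => (f k p.1, g k p.2))
      (fun p => (f k p.1, g k p.2))) := by
  refine SchmidtLE.sum fun k => ?_
  obtain ⟨ι, _, L, R, rfl⟩ := hX
  refine ⟨ι, inferInstance, fun i => (L i).submatrix (f k) id,
    fun i => (R i).submatrix id (g k), ?_⟩
  ext p q
  simp [Matrix.sum_apply, Matrix.vecMulVec_apply, Matrix.mul_apply]

/-- Every term in a decomposition of a pure state is proportional to that state. Here each `L i * R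
i` is therefore a scalar matrix; some scalar is nonzero, so the identity on `r` factors through `κ`
and the rank bounds `|r|`. -/
theorem card_le_of_schmidtLE_maxEnt {κ r : Type} [Fintype κ] [Fintype r] [DecidableEq r]
    [Nonempty r] (h : SchmidtLE κ (maxEnt r)) : Fintype.card r ≤ Fintype.card κ := by
  obtain ⟨ι, _, L, R, h⟩ := h
  have hent : ∀ x y x' y', maxEnt r (x, y) (x', y') =
      ∑ i, (L i * R i) x y * star ((L i * R i) x' y') := fun x y x' y' => by
    rw [h, Matrix.sum_apply]
    rfl
  have hsq : ∀ c : ι → ℂ, ∑ i, c i * star (c i) = 0 → ∀ i, c i = 0 := fun c hc i => by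
    rw [Finset.sum_eq_zero_iff_of_nonneg fun i _ => mul_star_self_nonneg _] at hc
    simpa using hc i (Finset.mem_univ i)
  have hoff : ∀ x y, x ≠ y → ∀ i, (L i * R i) x y = 0 := fun x y hxy =>
    hsq _ (by rw [← hent]; simp [maxEnt, hxy])
  -- The sum of `|(L i * R i) x x - (L i * R i) y y|²` is a combination of four entries of `maxEnt`,
  -- namely `(1 - 1 - 1 + 1) / |r| = 0`.
  have hdiag : ∀ x y i, (L i * R i) x x - (L i * R i) y y = 0 := fun x y =>
    hsq _ (by
      simp only [star_sub, mul_sub, sub_mul, Finset.sum_sub_distrib, ← hent]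
      simp [maxEnt])
  obtain ⟨x₀⟩ := ‹Nonempty r›
  obtain ⟨i, hi⟩ : ∃ i, (L i * R i) x₀ x₀ ≠ 0 := by
    by_contra! hcon
    have := hent x₀ x₀ x₀ x₀
    simp only [hcon, zero_mul, Finset.sum_const_zero] at this
    have : Nonempty r := ⟨x₀⟩
    simp [maxEnt] at *
  have hLR : L i * R i = (L i * R i) x₀ x₀ • (1 : Matrix r r ℂ) := by
    ext x y
    by_cases hxy : x = y
    · subst hxy
      simpa using sub_eq_zero.1 (hdiag x x₀ i)
    · simpa [hxy] using hoff x y hxy i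
  have hone : ((L i * R i) x₀ x₀)⁻¹ • L i * R i = (1 : Matrix r r ℂ) := by
    rw [Matrix.smul_mul]
    nth_rewrite 2 [hLR]
    rw [smul_smul, inv_mul_cancel₀ hi, one_smul]
  calc Fintype.card r = (1 : Matrix r r ℂ).rank := Matrix.rank_one.symm
    _ ≤ (((L i * R i) x₀ x₀)⁻¹ • L i).rank := hone ▸ Matrix.rank_mul_le_left _ _
    _ ≤ Fintype.card κ := Matrix.rank_le_card_width _

theorem basisState_apply {g h : Type} [Fintype g] [Fintype h] [DecidableEq g] [DecidableEq h]
    (i : g) (j : h) (p q : g × h) : (basisState (i, j)).1 p q =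
      (if p.1 = i ∧ p.2 = j then 1 else 0) * star (if q.1 = i ∧ q.2 = j then 1 else 0) := by
  simp only [basisState, Matrix.vecMulVec_apply, Pi.star_apply, Pi.single_apply, Prod.ext_iff]

/-- This evaluates the entries of `L * R` for the factors chosen in `exists_mem_bellSpec_schmidtLE`.
-/
theorem sum_ite_mul_ite {A B T : Type} [Fintype A] [DecidableEq A] [DecidableEq B] [DecidableEq T]
    (c : ℂ) (b : B) (u : T) (x y : A × B) (s t : T) :
    (∑ z, (if x.1 = z ∧ x.2 = b ∧ s = u then c else 0) *
      (if y.1 = z ∧ y.2 = b ∧ t = u then 1 else 0)) = (if x.1 = y.1 then c else 0) *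
      (if x.2 = b ∧ y.2 = b then 1 else 0) * (if s = u ∧ t = u then 1 else 0) := by
  rw [Finset.sum_eq_single x.1 (fun z _ hz => by simp [hz.symm]) (by simp)]
  by_cases h1 : x.1 = y.1 <;> by_cases h2 : x.2 = b <;> by_cases h3 : y.2 = b <;>
    by_cases h4 : s = u <;> by_cases h5 : t = u <;> simp [h1, h2, h3, h4, h5, eq_comm]

theorem exists_mem_bellSpec_schmidtLE (N n : ℕ) : ∃ σ ∈ bellSpec N n,
    SchmidtLE (Qubits {i : Fin N // i.val < n}) σ.1 := by
  -- The state is pure: `n` Bell pairs, everything else in the basis state `0`. One vector suffices;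
  -- the amplitude `1 / √(2ⁿ)` is put into the left factor.
  refine ⟨prodState (walletTarget N)
    (prodState (firstPairs N n) (maxEntState _) (basisState (0, 0))) (basisState (0, 0)), ?_,
    Unit, inferInstance,
    fun _ x z => if (firstQubits N n x.1).1 = z ∧ (firstQubits N n x.1).2 = 0 ∧ x.2 = 0
      then ((Real.sqrt (Fintype.card (Qubits {i : Fin N // i.val < n})) : ℝ) : ℂ)⁻¹ else 0,
    fun _ z y => if (firstQubits N n y.1).1 = z ∧ (firstQubits N n y.1).2 = 0 ∧ y.2 = 0
      then 1 else 0, ?_⟩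
  · rw [bellSpec, Set.mem_ofPred_eq, walletMarginal, marginal_prodState, marginal_prodState,
      bellProjector_eq_maxEnt]
    rfl
  · rw [Fintype.sum_unique]
    ext ⟨⟨x, s⟩, ⟨y, t⟩⟩ ⟨⟨x', s'⟩, ⟨y', t'⟩⟩
    change maxEnt _ (((firstQubits N n) x).1, ((firstQubits N n) y).1)
        (((firstQubits N n) x').1, ((firstQubits N n) y').1) *
      (basisState (0, 0)).1 (((firstQubits N n) x).2, ((firstQubits N n) y).2)
        (((firstQubits N n) x').2, ((firstQubits N n) y').2) *
      (basisState (0, 0)).1 (s, t) (s', t') = _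
    rw [maxEnt_eq_vecMulVec]
    rw [basisState_apply, basisState_apply, Matrix.vecMulVec_apply, Pi.star_apply]
    have key := sum_ite_mul_ite (A := Qubits {i : Fin N // i.val < n})
      ((Real.sqrt (Fintype.card (Qubits {i : Fin N // i.val < n})) : ℝ) : ℂ)⁻¹
      (0 : Qubits {i : Fin N // ¬ i.val < n}) (0 : Qubits (Fin N))
    refine Eq.trans ?_ (congrArg₂ (fun u v => u * star v)
      (key (firstQubits N n x) (firstQubits N n y) s t)
      (key (firstQubits N n x') (firstQubits N n y') s' t')).symm
    simp only [star_mul']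
    ring

theorem card_qubits_lt {N n : ℕ} (hn : n ≤ N) :
    Fintype.card (Qubits {i : Fin N // i.val < n}) = 2 ^ n := by
  rw [Fintype.card_fun, Fintype.card_fin, Fintype.card_subtype, Fin.card_filter_val_lt,
    min_eq_right hn]

theorem le_of_reaches_bellSpec {N m n : ℕ} (hm : m ≤ N) (hn : n ≤ N)
    (h : (loccTheory (Party N) (Party N)).Reaches (bellSpec N n) (bellSpec N m)) : m ≤ n := by
  obtain ⟨f, ⟨Λ, hΛ, hf⟩, hsub⟩ := h
  obtain ⟨σ, hσ, hS⟩ := exists_mem_bellSpec_schmidtLE N n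
  have hmem : hΛ.onState σ ∈ bellSpec N m := hsub (by rw [hf]; exact ⟨σ, hσ, rfl⟩)
  -- `γ` indexes the basis of all that is traced out to reach the first `m` pairs: the target and
  -- the remaining wallet qubits. `f` and `g` reinsert Alice's and Bob's shares.
  let γ := (Qubits (Fin N) × Qubits (Fin N)) ×
    (Qubits {i : Fin N // ¬ i.val < m} × Qubits {i : Fin N // ¬ i.val < m})
  let f (k : γ) (x : Qubits {i : Fin N // i.val < m}) : Party N :=
    ((firstQubits N m).symm (x, k.2.1), k.1.1)
  let g (k : γ) (x : Qubits {i : Fin N // i.val < m}) : Party N :=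
    ((firstQubits N m).symm (x, k.2.2), k.1.2)
  have hP : maxEnt (Qubits {i : Fin N // i.val < m}) =
      ∑ k, (Λ σ.1).submatrix (fun p : _ × _ => (f k p.1, g k p.2))
        (fun p => (f k p.1, g k p.2)) := by
    ext p q
    rw [mem_bellSpec_iff] at hmem
    refine (hmem p.1 p.2 q.1 q.2).symm.trans ?_
    rw [Matrix.sum_apply, Fintype.sum_prod_type_right, Fintype.sum_prod_type]
    rfl
  have := card_le_of_schmidtLE_maxEnt (hP ▸ (hΛ.schmidtLE hS).marginal f g)
  rwa [card_qubits_lt hm, card_qubits_lt hn, Nat.pow_le_pow_iff_right (by norm_num)] at this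

/-! ### Teleportation -/

theorem conj_mul {l m n : Type} [Fintype m] [Fintype n] (A : Matrix l m ℂ) (B : Matrix m n ℂ)
    (X : Matrix n n ℂ) : conj (A * B) X = conj A (conj B X) := by
  change A * B * X * (A * B).conjTranspose = A * (B * X * B.conjTranspose) * A.conjTranspose
  rw [Matrix.conjTranspose_mul]
  simp only [Matrix.mul_assoc]

/-! ### One-way protocols; discarding and appending registers -/

section oneWay

variable {a b a' b' κ l : Type} [Fintype a] [DecidableEq a] [Fintype b] [DecidableEq b]
  [Fintype a'] [DecidableEq a'] [Fintype b'] [DecidableEq b'] [Fintype κ] [Fintype l]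

/-- One-way LOCC: Alice applies an instrument and Bob a channel depending on its outcome. -/
theorem IsLOCC.oneWay (A : κ → Matrix a' a ℂ) (hA : ∑ k, (A k).conjTranspose * A k = 1)
    (B : κ → l → Matrix b' b ℂ) (hB : ∀ k, ∑ i, (B k i).conjTranspose * B k i = 1) :
    IsLOCC (∑ k, ∑ i, conj (A k ⊗ₖ B k i)) := by
  have h := IsLOCC.alice A hA _ fun k =>
    IsLOCC.bob (a := a') (B k) (hB k) _ fun _ => IsLOCC.done (a' := a') (b' := b')
  convert h using 1
  refine Finset.sum_congr rfl fun k _ => ?_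
  ext1 X
  simp only [LinearMap.id_comp, LinearMap.comp_apply, LinearMap.sum_apply]
  refine Finset.sum_congr rfl fun i _ => ?_
  have hAB : A k ⊗ₖ B k i = ((1 : Matrix a' a' ℂ) ⊗ₖ B k i) * (A k ⊗ₖ (1 : Matrix b b ℂ)) := by
    rw [← Matrix.mul_kronecker_mul, Matrix.one_mul, Matrix.mul_one]
  rw [hAB, conj_mul]

end oneWay

theorem conj_one_submatrix_id {m n : Type} [Fintype n] [DecidableEq n] (f : m → n)
    (X : Matrix n n ℂ) : conj ((1 : Matrix n n ℂ).submatrix f id) X = X.submatrix f f := by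
  change (1 : Matrix n n ℂ).submatrix f id * X * ((1 : Matrix n n ℂ).submatrix f id).conjTranspose
    = X.submatrix f f
  ext i j
  simp [Matrix.mul_apply, Matrix.one_apply]

theorem one_submatrix_kronecker {m n m' n' : Type} [DecidableEq n] [DecidableEq n']
    (f : m → n) (f' : m' → n') :
    (1 : Matrix n n ℂ).submatrix f id ⊗ₖ (1 : Matrix n' n' ℂ).submatrix f' id =
      (1 : Matrix (n × n') (n × n') ℂ).submatrix (Prod.map f f') id := by
  rw [← Matrix.one_kronecker_one]
  rfl

/-- Completeness of the Kraus operators `1 ⊗ ⟨k|` of the partial trace. -/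
theorem sum_conjTranspose_discard (r t : Type) [Fintype r] [DecidableEq r] [Fintype t]
    [DecidableEq t] :
    ∑ k : t, ((1 : Matrix (r × t) (r × t) ℂ).submatrix (fun x => (x, k)) id).conjTranspose *
      (1 : Matrix (r × t) (r × t) ℂ).submatrix (fun x => (x, k)) id = 1 := by
  ext ⟨x, z⟩ ⟨y, w⟩
  simp only [Matrix.sum_apply, Matrix.mul_apply, Matrix.conjTranspose_apply, Matrix.submatrix_apply,
    Matrix.one_apply, id]
  rw [Finset.sum_comm, ← Fintype.sum_prod_type' (fun x' k => star (if (x', k) = (x, z) then (1 : ℂ)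
    else 0) * if (x', k) = (y, w) then (1 : ℂ) else 0)]
  simp [apply_ite star, eq_comm]

/-- Discarding the target systems is an LOCC channel. -/
theorem exists_isLOCC_discard (r t r' t' : Type) [Fintype r] [DecidableEq r] [Fintype t]
    [DecidableEq t] [Fintype r'] [DecidableEq r'] [Fintype t'] [DecidableEq t'] :
    ∃ Λ : Matrix ((r × t) × (r' × t')) ((r × t) × (r' × t')) ℂ →ₗ[ℂ]
        Matrix (r × r') (r × r') ℂ,
      IsLOCC Λ ∧ ∀ X, Λ X = partialTrace (Equiv.prodProdProdComm _ _ _ _) X := by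
  refine ⟨_, IsLOCC.oneWay _ (sum_conjTranspose_discard r t) (fun _ => _)
    fun _ => sum_conjTranspose_discard r' t', fun X => ?_⟩
  simp only [LinearMap.sum_apply, one_submatrix_kronecker, conj_one_submatrix_id]
  ext p q
  simp only [Matrix.sum_apply, partialTrace, Fintype.sum_prod_type]
  rfl

theorem conjTranspose_mul_id_submatrix {m n : Type} [Fintype m] [DecidableEq m]
    [DecidableEq n] (f : n → m) (hf : Function.Injective f) :
    ((1 : Matrix m m ℂ).submatrix id f).conjTranspose * (1 : Matrix m m ℂ).submatrix id f = 1 := by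
  rw [Matrix.conjTranspose_submatrix, Matrix.conjTranspose_one,
    ← Matrix.submatrix_mul _ _ _ _ _ Function.bijective_id, Matrix.one_mul,
    Matrix.submatrix_one f hf]

/-- Appending local registers in a fixed basis state is an LOCC channel. -/
theorem exists_isLOCC_append (r t r' t' : Type) [Fintype r] [DecidableEq r] [Fintype t]
    [DecidableEq t] [Fintype r'] [DecidableEq r'] [Fintype t'] [DecidableEq t'] (u : r) (u' : r') :
    ∃ Λ : Matrix (t × t') (t × t') ℂ →ₗ[ℂ]
        Matrix ((r × t) × (r' × t')) ((r × t) × (r' × t')) ℂ,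
      IsLOCC Λ ∧ ∀ ρ : State (t × t'),
        Λ ρ.1 = (prodState (Equiv.prodProdProdComm _ _ _ _) (basisState (u, u')) ρ).1 := by
  refine ⟨_, IsLOCC.oneWay (κ := Unit) (l := Unit)
    (fun _ => (1 : Matrix (r × t) (r × t) ℂ).submatrix id (fun x => (u, x)))
    (by simpa using conjTranspose_mul_id_submatrix _ (Prod.mk_right_injective u))
    (fun _ _ => (1 : Matrix (r' × t') (r' × t') ℂ).submatrix id (fun x => (u', x)))
    (fun _ => by simpa using conjTranspose_mul_id_submatrix _ (Prod.mk_right_injective u')),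
    fun ρ => ?_⟩
  simp only [Fintype.sum_unique]
  ext ⟨⟨x, s⟩, ⟨y, w⟩⟩ ⟨⟨x', s'⟩, ⟨y', w'⟩⟩
  change (((1 : Matrix (r × t) (r × t) ℂ).submatrix id (fun x => (u, x)) ⊗ₖ
    (1 : Matrix (r' × t') (r' × t') ℂ).submatrix id (fun x => (u', x))) * ρ.1 *
    ((1 : Matrix (r × t) (r × t) ℂ).submatrix id (fun x => (u, x)) ⊗ₖ
    (1 : Matrix (r' × t') (r' × t') ℂ).submatrix id (fun x => (u', x))).conjTranspose)
     ((x, s), (y, w)) ((x', s'), (y', w')) =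
    (basisState (u, u')).1 (x, y) (x', y') * ρ.1 (s, w) (s', w')
  rw [basisState_apply]
  by_cases h1 : x = u <;> by_cases h2 : y = u' <;> by_cases h3 : x' = u <;>
    by_cases h4 : y' = u' <;>
    simp [Matrix.mul_apply, Matrix.one_apply, Fintype.sum_prod_type, h1, h2, h3, h4,
      apply_ite star]

/-! ### Twirling by signs and shifts, and teleportation -/

section twirl

variable {G : Type} [Fintype G] [DecidableEq G]

theorem sum_signs (y y' : G) : ∑ ε : G → ℤˣ, ((ε y : ℤ) : ℂ) * ((ε y' : ℤ) : ℂ) =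
    if y = y' then (Fintype.card (G → ℤˣ) : ℂ) else 0 := by
  split_ifs with h
  · subst h
    simp [← Int.cast_mul, ← Units.val_mul, Int.units_mul_self]
  -- Flipping the sign at `y` permutes the sign patterns and negates each summand, so the sum equals
  -- its own negative.
  · have hs := Equiv.sum_comp (Equiv.mulRight (Function.update (1 : G → ℤˣ) y (-1)))
      fun ε : G → ℤˣ => ((ε y : ℤ) : ℂ) * ((ε y' : ℤ) : ℂ)
    simp [Function.update_of_ne (Ne.symm h)] at hs
    simpa [neg_eq_self] using hs

variable [AddCommGroup G]

/-- A sign change followed by a shift. -/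
def signShift (u : G × (G → ℤˣ)) : Matrix G G ℂ :=
  fun x y => if x = y + u.1 then ((u.2 y : ℤ) : ℂ) else 0

theorem signShift_mul_apply (u : G × (G → ℤˣ)) (Q : Matrix G G ℂ) (x x' : G) :
    (signShift u * Q * (signShift u).conjTranspose) x x' =
      ((u.2 (x - u.1) : ℤ) : ℂ) * ((u.2 (x' - u.1) : ℤ) : ℂ) * Q (x - u.1) (x' - u.1) := by
  have h : ∀ x y : G, x = y + u.1 ↔ y = x - u.1 := fun x y => by rw [eq_sub_iff_add_eq, eq_comm]
  simp [Matrix.mul_apply, signShift, h, apply_ite star]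
  ring

theorem signShift_mul_conjTranspose (u : G × (G → ℤˣ)) :
    signShift u * (signShift u).conjTranspose = 1 := by
  ext x x'
  have := signShift_mul_apply u 1 x x'
  rw [Matrix.mul_one] at this
  rw [this]
  by_cases h : x = x'
  · subst h
    simp [← Int.cast_mul, ← Units.val_mul, Int.units_mul_self]
  · simp [h]

/-- Summing over signs kills the off-diagonal entries, and summing over shifts spreads the trace
evenly over the diagonal. Signs play the role of the phases in the usual Weyl operators. -/
theorem sum_signShift_conj (Q : Matrix G G ℂ) :
    ∑ u, signShift u * Q * (signShift u).conjTranspose =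
      ((Fintype.card (G → ℤˣ) : ℂ) * Q.trace) • (1 : Matrix G G ℂ) := by
  ext x x'
  simp only [Matrix.sum_apply, signShift_mul_apply, Fintype.sum_prod_type, ← Finset.sum_mul,
    sum_signs, sub_left_inj]
  by_cases h : x = x'
  · subst h
    simp [← Finset.mul_sum, Matrix.trace]
    exact (Equiv.subLeft x).sum_comp fun y => Q y y
  · simp [h]

/-- Teleportation: any state can be prepared by LOCC from a maximally entangled state. -/
theorem exists_isLOCC_prepare [Nonempty G] {a : Type} [Fintype a] [DecidableEq a]
    (ρ : State (a × G)) :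
    ∃ Λ : Matrix (G × G) (G × G) ℂ →ₗ[ℂ] Matrix (a × G) (a × G) ℂ,
      IsLOCC Λ ∧ Λ (maxEnt G) = ρ.1 := by
  obtain ⟨m, v, hv⟩ := Matrix.posSemidef_iff_eq_sum_vecMulVec.1 ρ.2.1
  let M (j : Fin m) : Matrix a G ℂ := fun x y => v j (x, y)
  set s : ℂ := (Fintype.card (G → ℤˣ) : ℂ) with hs
  set d : ℂ := (Fintype.card G : ℂ) with hd
  have hs0 : s ≠ 0 := by simp [hs]
  have hd0 : d ≠ 0 := by simp [hd]
  have hsqrt : ∀ n : ℕ, ((Real.sqrt n : ℝ) : ℂ) * ((Real.sqrt n : ℝ) : ℂ) = n := fun n => by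
    rw [← Complex.ofReal_mul, Real.mul_self_sqrt (Nat.cast_nonneg _), Complex.ofReal_natCast]
  let c : ℂ := ((Real.sqrt (Fintype.card (G → ℤˣ)) : ℝ) : ℂ)⁻¹
  let e : ℂ := ((Real.sqrt (Fintype.card G) : ℝ) : ℂ)⁻¹
  have hc : star c * c = s⁻¹ := by
    simp only [c, Complex.star_def, map_inv₀, Complex.conj_ofReal]
    rw [← mul_inv, hsqrt]
  have he : star e * e = d⁻¹ := by
    simp only [e, Complex.star_def, map_inv₀, Complex.conj_ofReal]
    rw [← mul_inv, hsqrt]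
  have htr : (∑ j, (M j).conjTranspose * M j).trace = 1 := by
    rw [← ρ.2.2, hv, Matrix.trace_sum, Matrix.trace_sum]
    refine Finset.sum_congr rfl fun j _ => ?_
    simp only [Matrix.trace, Matrix.diag, Matrix.mul_apply, Matrix.conjTranspose_apply,
      Matrix.vecMulVec_apply, Fintype.sum_prod_type, Pi.star_apply]
    rw [Finset.sum_comm]
    exact Finset.sum_congr rfl fun _ _ => Finset.sum_congr rfl fun _ _ => mul_comm _ _
  -- With `U = signShift u`, Alice's Kraus operators `c Mⱼ Uᴴ` merge the local preparation of `ρ`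
  -- with the teleportation measurement; Bob's correction is `Uᵀ`.
  refine ⟨_, IsLOCC.oneWay (κ := Fin m × (G × (G → ℤˣ))) (l := Unit)
    (fun k => c • (M k.1 * (signShift k.2).conjTranspose)) ?_
    (fun k _ => (signShift k.2).transpose) (fun k => ?_), ?_⟩
  -- Completeness: the twirl sends `∑ⱼ Mⱼᴴ Mⱼ`, of trace `1`, to `s • 1`, which fixes `c =
  -- s^(-1/2)`.
  · have h : ∀ (j : Fin m) (u : G × (G → ℤˣ)),
        (c • (M j * (signShift u).conjTranspose)).conjTranspose *
          (c • (M j * (signShift u).conjTranspose)) =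
        s⁻¹ • (signShift u * ((M j).conjTranspose * M j) * (signShift u).conjTranspose) := by
      intro j u
      rw [Matrix.conjTranspose_smul, Matrix.smul_mul, Matrix.mul_smul, smul_smul, hc,
        Matrix.conjTranspose_mul, Matrix.conjTranspose_conjTranspose]
      simp only [Matrix.mul_assoc]
    rw [Fintype.sum_prod_type_right]
    simp only [h, ← Finset.smul_sum, ← Finset.sum_mul, ← Finset.mul_sum]
    rw [sum_signShift_conj, htr, mul_one, smul_smul, inv_mul_cancel₀ hs0, one_smul]
  · rw [Fintype.sum_unique, Matrix.conjTranspose_transpose_eq_transpose_conjTranspose,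
      ← Matrix.transpose_mul, signShift_mul_conjTranspose, Matrix.transpose_one]
  -- The resource has coefficient matrix `e • 1`, so outcome `(j, u)` gives `c e Mⱼ Uᴴ U = c e Mⱼ`,
  -- independent of `u`. The `s d` values of `u` cancel the weight `(s d)⁻¹`.
  · have hV : (fun p : G × G => if p.1 = p.2 then e else 0) =
        fun p => (e • (1 : Matrix G G ℂ)) p.1 p.2 := by
      ext p
      simp [Matrix.one_apply]
    have h : ∀ (j : Fin m) (u : G × (G → ℤˣ)),
        conj ((c • (M j * (signShift u).conjTranspose)) ⊗ₖ (signShift u).transpose) (maxEnt G) =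
          (s * d)⁻¹ • Matrix.vecMulVec (v j) (star (v j)) := by
      intro j u
      have hU : (c • (M j * (signShift u).conjTranspose)) * (e • (1 : Matrix G G ℂ)) *
          (signShift u).transpose.transpose = (c * e) • M j := by
        rw [Matrix.transpose_transpose, Matrix.mul_smul, Matrix.mul_one, smul_smul,
          Matrix.smul_mul, Matrix.mul_assoc,
          mul_eq_one_comm.1 (signShift_mul_conjTranspose u), Matrix.mul_one, mul_comm e]
      rw [maxEnt_eq_vecMulVec, conj_vecMulVec, hV, kronecker_mulVec_uncurry, hU]
      ext p q
      change (c * e * v j p) * star (c * e * v j q) = (s * d)⁻¹ * (v j p * star (v j q))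
      simp only [star_mul', mul_inv, ← hc, ← he]
      ring
    simp only [LinearMap.sum_apply, Fintype.sum_prod_type_right, Fintype.sum_unique, h]
    rw [hv]
    simp only [← Finset.smul_sum, Finset.sum_const, Finset.card_univ, ← Nat.cast_smul_eq_nsmul ℂ,
      smul_smul]
    rw [← hs, ← hd, mul_assoc, mul_comm d, inv_mul_cancel₀ (mul_ne_zero hs0 hd0),
      one_smul]

end twirl

/-! ### Bell pairs as a currency -/

theorem reaches_of_subset {Ω : Type*} (R : ResourceTheory Ω) {V W : Set Ω} (h : V ⊆ W) :
    R.Reaches V W :=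
  ⟨_, R.id_mem, h⟩

theorem reaches_bellSpec_localSpec {N : ℕ} {T : Set (State (Qubits (Fin N) × Qubits (Fin N)))}
    (hT : T.Nonempty) :
    (loccTheory (Party N) (Party N)).Reaches (bellSpec N N) (localSpec T) := by
  obtain ⟨ρ, hρ⟩ := hT
  obtain ⟨D, hD, hDX⟩ := exists_isLOCC_discard (Qubits (Fin N)) (Qubits (Fin N)) (Qubits (Fin N))
    (Qubits (Fin N))
  obtain ⟨P, hP, hPX⟩ := exists_isLOCC_prepare ρ
  obtain ⟨E, hE, hEX⟩ := exists_isLOCC_append (Qubits (Fin N)) (Qubits (Fin N)) (Qubits (Fin N))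
    (Qubits (Fin N)) 0 0
  -- Discard the old target, turn the wallet into `ρ`, relabel that as the new target and append a
  -- blank wallet.
  refine ⟨_, ⟨_, (hD.comp hP).comp hE, fun V => rfl⟩, ?_⟩
  rintro _ ⟨σ, hσ, rfl⟩
  have hDσ : D σ.1 = maxEnt (Qubits (Fin N)) :=
    (hDX σ.1).trans (walletMarginal_of_mem_bellSpec hσ)
  have hout : ((hD.comp hP).comp hE).onState σ =
      prodState (walletTarget N) (basisState (0, 0)) ρ := by
    refine Subtype.ext ?_
    change E (P (D σ.1)) = _
    rw [hDσ, hPX, hEX]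
    rfl
  rw [hout, localSpec, Set.mem_ofPred_eq, targetMarginal, marginal_prodComm_prodState]
  exact hρ

theorem mem_bellCurrency_iff {N : ℕ} {C : Set (Global N)} :
    C ∈ bellCurrency N ↔ ∃ n ≤ N, C = bellSpec N n := by
  constructor
  · rintro (⟨n, -, hn, rfl⟩ | rfl)
    · exact ⟨n, hn, rfl⟩
    · exact ⟨0, Nat.zero_le N, (bellSpec_zero N).symm⟩
  · rintro ⟨n, hn, rfl⟩
    obtain rfl | h := Nat.eq_zero_or_pos n
    · exact Or.inr (bellSpec_zero N)
    · exact Or.inl ⟨n, h, hn, rfl⟩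

theorem reaches_bellSpec_iff {N m n : ℕ} (hm : m ≤ N) (hn : n ≤ N) :
    (loccTheory (Party N) (Party N)).Reaches (bellSpec N n) (bellSpec N m) ↔ m ≤ n :=
  ⟨le_of_reaches_bellSpec hm hn, fun h => reaches_of_subset _ (bellSpec_anti h)⟩

theorem bellSpec_injective {N m n : ℕ} (hm : m ≤ N) (hn : n ≤ N)
    (h : bellSpec N m = bellSpec N n) : m = n :=
  le_antisymm ((reaches_bellSpec_iff hm hn).1 (reaches_of_subset _ h.ge))
    ((reaches_bellSpec_iff hn hm).1 (reaches_of_subset _ h.le))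

theorem exists_localSpec_of_mem_insert {N : ℕ} {𝒮 : Set (Set (Global N))} (h𝒮 : 𝒮 ⊆ localSpecs N)
    {V : Set (Global N)} (hV : V ∈ insert Set.univ 𝒮) :
    ∃ T : Set (State (Qubits (Fin N) × Qubits (Fin N))), T.Nonempty ∧ V = localSpec T := by
  obtain rfl | hV := hV
  -- `Ω` is itself local, with `T` the set of all states of `A'B'`.
  · exact ⟨Set.univ, ⟨basisState 0, trivial⟩, rfl⟩
  · exact h𝒮 hV

/-- The number of Bell pairs guaranteed by a specification of the currency. -/
def bellValue (N : ℕ) (C : Set (Global N)) : NNReal :=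
  ((sSup {n : ℕ | n ≤ N ∧ C = bellSpec N n} : ℕ) : NNReal)

/-- Distinct `n ≤ N` give distinct `Ψⁿ`, so the supremum runs over a singleton. -/
theorem bellValue_bellSpec {N n : ℕ} (hn : n ≤ N) : bellValue N (bellSpec N n) = n := by
  have : {m : ℕ | m ≤ N ∧ bellSpec N n = bellSpec N m} = {n} := by
    ext m
    exact ⟨fun h => (bellSpec_injective hn h.1 h.2).symm, by rintro rfl; exact ⟨hn, rfl⟩⟩
  rw [bellValue, this, csSup_singleton]

end BellCurrency
end

/-! ### Currency, independence and value function -/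

open BellCurrency in
theorem mainTheorem10 (N : ℕ) (𝒮 : Set (Set (BellCurrency.Global N)))
    (h𝒮 : 𝒮 ⊆ BellCurrency.localSpecs N) :
    BellCurrency.IsCurrency (BellCurrency.loccTheory (BellCurrency.Party N) (BellCurrency.Party N))
      (BellCurrency.bellCurrency N) (insert Set.univ 𝒮) ∧
    BellCurrency.IsIndependent
      (BellCurrency.loccTheory (BellCurrency.Party N) (BellCurrency.Party N))
      (BellCurrency.bellCurrency N) (insert Set.univ 𝒮) ∧
    ∃ val : Set (BellCurrency.Global N) → NNReal,
      BellCurrency.IsValueFunction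
        (BellCurrency.loccTheory (BellCurrency.Party N) (BellCurrency.Party N))
        (BellCurrency.bellCurrency N) val ∧
      ∀ n, 1 ≤ n → n ≤ N → val (BellCurrency.bellSpec N n) = n := by
  have hcompat : ∀ C ∈ bellCurrency N, ∀ V ∈ insert Set.univ 𝒮, (C ∩ V).Nonempty := by
    intro C hC V hV
    obtain ⟨n, -, rfl⟩ := mem_bellCurrency_iff.1 hC
    obtain ⟨T, hT, rfl⟩ := exists_localSpec_of_mem_insert h𝒮 hV
    exact bellSpec_inter_localSpec_nonempty hT n
  have huniv : Set.univ ∈ bellCurrency N := Or.inr rfl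
  refine ⟨⟨fun C hC => (hcompat C hC _ (Set.mem_insert _ _)).left,
      fun V hV => (hcompat _ huniv V hV).right, ?_, huniv, ?_,
      fun V _ => ⟨_, huniv, reaches_of_subset _ (Set.subset_univ V)⟩, Set.mem_insert _ _⟩,
    ⟨hcompat, ?_⟩, bellValue N, ⟨?_, ?_⟩, fun n _ hn => bellValue_bellSpec hn⟩
  · intro C hC C' hC'
    obtain ⟨n, -, rfl⟩ := mem_bellCurrency_iff.1 hC
    obtain ⟨m, -, rfl⟩ := mem_bellCurrency_iff.1 hC'
    exact (le_total m n).imp (fun h => reaches_of_subset _ (bellSpec_anti h))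
      fun h => reaches_of_subset _ (bellSpec_anti h)
  · intro V hV
    obtain ⟨T, hT, rfl⟩ := exists_localSpec_of_mem_insert h𝒮 hV
    exact ⟨_, mem_bellCurrency_iff.2 ⟨N, le_rfl, rfl⟩, reaches_bellSpec_localSpec hT⟩
  · intro C hC C' hC' h V _
    obtain ⟨n, hn, rfl⟩ := mem_bellCurrency_iff.1 hC
    obtain ⟨m, hm, rfl⟩ := mem_bellCurrency_iff.1 hC'
    -- Reachability forces `m ≤ n`, hence an inclusion, so the identity channel works whatever
    -- channel was given.
    exact reaches_of_subset _
      (Set.inter_subset_inter_left V (bellSpec_anti ((reaches_bellSpec_iff hm hn).1 h)))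
  · intro C hC C' hC'
    obtain ⟨n, hn, rfl⟩ := mem_bellCurrency_iff.1 hC
    obtain ⟨m, hm, rfl⟩ := mem_bellCurrency_iff.1 hC'
    rw [bellValue_bellSpec hn, bellValue_bellSpec hm, Nat.cast_le, reaches_bellSpec_iff hn hm]
  · rw [← bellSpec_zero, bellValue_bellSpec (Nat.zero_le N), Nat.cast_zero]
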